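/- Consider programs for a random access machine that stores natural numbers (counters and addresses, with addition, subtraction and comparison) and elements of an ordered field (with $+,-,\times,/$ and comparison). For integers $m,n\ge 0$, $0\le k\le \min\{m,n\}$ and $A\in\mathbb{R}^{m\times n}$, let $\mathcal I=\binom{[m]}{k}\times\binom{[n]}{k}$; for $S=(I,J)\in\mathcal I$ let $A_S$ be the $k\times k$ submatrix of $A$ with rows $I$ and columns $J$, and let $$\operatorname{maxdet}_k(A)=\max\{|\det(A_S)| : S\in\mathcal I\}.$$ Then there are a single program, an absolute constant $c$, and polynomials $p,q$ such that, on every input $(m,n,k,A)$ as above, the program halts and returns $S_0\in\mathcal I$ with $$(n+m)^{ck}\cdot|\det(A_{S_0})|\ \ge\ \operatorname{maxdet}_k(A),$$ and its running time is polynomial in both usual senses: 1. for $A\in\mathbb{R}^{m\times n}$, with exact real arithmetic at unit cost per operation, the running time is at most $p(m+n)$; 2. for $A\in\mathbb{Q}^{m\times n}$, with each operation charged the bit lengths of the numbers involved, the running time is at most $q(L)$, where $L$ is $m+n$ plus the total bit length of the entries of $A$. -/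

import Mathlib

namespace Subdet

/-! ### Subdeterminants -/

/-- The family of pairs (set of `k` rows, set of `k` columns) of an `m × n` matrix. -/
abbrev IndexPair (m n k : ℕ) : Type :=
  {I : Finset (Fin m) // I.card = k} × {J : Finset (Fin n) // J.card = k}

/-- The determinant of the submatrix with rows `S.1` and columns `S.2`, both in increasing order. -/
noncomputable def minor {m n k : ℕ} (A : Matrix (Fin m) (Fin n) ℝ) (S : IndexPair m n k) : ℝ :=
  (A.submatrix (S.1.1.orderEmbOfFin S.1.2) (S.2.1.orderEmbOfFin S.2.2)).det

/-- The maximum absolute value of a `k × k` subdeterminant. The supremum is over a finite family,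
which is nonempty when `k ≤ m` and `k ≤ n`, and then it is a maximum. -/
noncomputable def maxdet {m n : ℕ} (k : ℕ) (A : Matrix (Fin m) (Fin n) ℝ) : ℝ :=
  ⨆ S : IndexPair m n k, |minor A S|

/-! ### Random access machines

Programs handle two kinds of data: natural numbers (used for loop counters and addresses), held in
arrays indexed by one address, and elements of an ordered field `K`, held in arrays indexed by two
addresses. A program is a finite object that does not depend on `K`. Field elements can only be
copied, combined by the four field operations and compared; there is no rounding. On addresses
there is only addition and subtraction, so that no huge integers arise in few steps. -/

/-- The memory: cell `i` of integer array `a` is `ints a i`, cell `(i, j)` of number array `a` is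
`nums a i j`. -/
structure Store (K : Type) where
  ints : ℕ → ℕ → ℕ
  nums : ℕ → ℕ → ℕ → K

/-- Integer expressions; `get a e` reads the cell with address `e` of integer array `a`. -/
inductive IExp : Type
  | lit (c : ℕ)
  | get (a : ℕ) (e : IExp)
  | add (e f : IExp)
  | sub (e f : IExp)

/-- Number expressions; `get a e f` reads the cell with address `(e, f)` of number array `a`. -/
inductive NExp : Type
  | lit (c : ℕ)
  | get (a : ℕ) (e f : IExp)
  | add (x y : NExp)
  | sub (x y : NExp)
  | mul (x y : NExp)
  | div (x y : NExp)

/-- Tests. -/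
inductive Test : Type
  | ilt (e f : IExp)
  | nlt (x y : NExp)
  | not (b : Test)
  | and (b c : Test)

/-- Programs. `setInt a e f` stores the value of `f` in cell `e` of integer array `a`;
`setNum a e f x` stores the value of `x` in cell `(e, f)` of number array `a`. -/
inductive Prog : Type
  | skip
  | setInt (a : ℕ) (e f : IExp)
  | setNum (a : ℕ) (e f : IExp) (x : NExp)
  | seq (P Q : Prog)
  | branch (b : Test) (P Q : Prog)
  | loop (b : Test) (P : Prog)

/-- What is charged for producing (reading, or computing by one operation) a given integer or
number. -/
structure CostModel (K : Type) where
  int : ℕ → ℕ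
  num : K → ℕ

/-- Every operation costs one unit, whatever the operands. -/
def unitCost (K : Type) : CostModel K where
  int _ := 1
  num _ := 1

/-- The bit length of a rational number, written as a reduced fraction with a sign. -/
def bitLength (q : ℚ) : ℕ := Nat.size q.num.natAbs + Nat.size q.den + 1

/-- Every operation costs the number of bits of its result. (The operands are results of earlier
operations, so they are charged as well.) -/
def bitCost : CostModel ℚ where
  int c := Nat.size c + 1
  num := bitLength

section Semantics

variable {K : Type}

/-- The value of an integer expression; subtraction is truncated at `0`. -/
def IExp.eval (σ : Store K) : IExp → ℕ
  | .lit c => c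
  | .get a e => σ.ints a (e.eval σ)
  | .add e f => e.eval σ + f.eval σ
  | .sub e f => e.eval σ - f.eval σ

/-- The cost of evaluating an integer expression: the sum of the charges over its nodes. -/
def IExp.cost (M : CostModel K) (σ : Store K) : IExp → ℕ
  | .lit c => M.int c
  | .get a e => e.cost M σ + M.int ((IExp.get a e).eval σ)
  | .add e f => e.cost M σ + f.cost M σ + M.int ((IExp.add e f).eval σ)
  | .sub e f => e.cost M σ + f.cost M σ + M.int ((IExp.sub e f).eval σ)

/-- The value of a number expression; a division by `0` returns `0`. -/
def NExp.eval [Field K] (σ : Store K) : NExp → K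
  | .lit c => (c : K)
  | .get a e f => σ.nums a (e.eval σ) (f.eval σ)
  | .add x y => x.eval σ + y.eval σ
  | .sub x y => x.eval σ - y.eval σ
  | .mul x y => x.eval σ * y.eval σ
  | .div x y => x.eval σ / y.eval σ

/-- The cost of evaluating a number expression: the sum of the charges over its nodes. -/
def NExp.cost [Field K] (M : CostModel K) (σ : Store K) : NExp → ℕ
  | .lit c => M.num (c : K)
  | .get a e f => e.cost M σ + f.cost M σ + M.num ((NExp.get a e f).eval σ)
  | .add x y => x.cost M σ + y.cost M σ + M.num ((NExp.add x y).eval σ)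
  | .sub x y => x.cost M σ + y.cost M σ + M.num ((NExp.sub x y).eval σ)
  | .mul x y => x.cost M σ + y.cost M σ + M.num ((NExp.mul x y).eval σ)
  | .div x y => x.cost M σ + y.cost M σ + M.num ((NExp.div x y).eval σ)

/-- Whether a test succeeds. -/
def Test.Holds [Field K] [LinearOrder K] (σ : Store K) : Test → Prop
  | .ilt e f => e.eval σ < f.eval σ
  | .nlt x y => x.eval σ < y.eval σ
  | .not b => ¬ b.Holds σ
  | .and b c => b.Holds σ ∧ c.Holds σ

/-- The cost of a test. -/
def Test.cost [Field K] (M : CostModel K) (σ : Store K) : Test → ℕ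
  | .ilt e f => e.cost M σ + f.cost M σ + 1
  | .nlt x y => x.cost M σ + y.cost M σ + 1
  | .not b => b.cost M σ + 1
  | .and b c => b.cost M σ + c.cost M σ + 1

/-- The store after writing `v` to cell `i` of integer array `a`. -/
def Store.writeInt (σ : Store K) (a i v : ℕ) : Store K where
  ints := fun a' i' => if a' = a ∧ i' = i then v else σ.ints a' i'
  nums := σ.nums

/-- The store after writing `v` to cell `(i, j)` of number array `a`. -/
def Store.writeNum (σ : Store K) (a i j : ℕ) (v : K) : Store K where
  ints := σ.ints
  nums := fun a' i' j' => if a' = a ∧ i' = i ∧ j' = j then v else σ.nums a' i' j'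

/-- `Exec M P σ t τ`: started in the store `σ`, the program `P` halts in the store `τ`, and the
total cost of this run is `t`. -/
inductive Exec [Field K] [LinearOrder K] (M : CostModel K) :
    Prog → Store K → ℕ → Store K → Prop
  | skip (σ : Store K) : Exec M .skip σ 1 σ
  | setInt (σ : Store K) (a : ℕ) (e f : IExp) :
      Exec M (.setInt a e f) σ (e.cost M σ + f.cost M σ + 1)
        (σ.writeInt a (e.eval σ) (f.eval σ))
  | setNum (σ : Store K) (a : ℕ) (e f : IExp) (x : NExp) :
      Exec M (.setNum a e f x) σ (e.cost M σ + f.cost M σ + x.cost M σ + 1)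
        (σ.writeNum a (e.eval σ) (f.eval σ) (x.eval σ))
  | seq {P Q : Prog} {σ τ υ : Store K} {s t : ℕ} (hP : Exec M P σ s τ) (hQ : Exec M Q τ t υ) :
      Exec M (.seq P Q) σ (s + t) υ
  | branch_true {b : Test} {P Q : Prog} {σ τ : Store K} {t : ℕ} (hb : b.Holds σ)
      (hP : Exec M P σ t τ) : Exec M (.branch b P Q) σ (b.cost M σ + t) τ
  | branch_false {b : Test} {P Q : Prog} {σ τ : Store K} {t : ℕ} (hb : ¬ b.Holds σ)
      (hQ : Exec M Q σ t τ) : Exec M (.branch b P Q) σ (b.cost M σ + t) τ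
  | loop_true {b : Test} {P : Prog} {σ τ υ : Store K} {s t : ℕ} (hb : b.Holds σ)
      (hP : Exec M P σ s τ) (hL : Exec M (.loop b P) τ t υ) :
      Exec M (.loop b P) σ (b.cost M σ + s + t) υ
  | loop_false {b : Test} {P : Prog} {σ : Store K} (hb : ¬ b.Holds σ) :
      Exec M (.loop b P) σ (b.cost M σ) σ

end Semantics

/-! ### Input and output -/

/-- The initial store: `m`, `n`, `k` are in cells `0`, `1`, `2` of integer array `0`, the matrix is
in number array `0`, and everything else is `0`. -/
def input {K : Type} [Zero K] {m n : ℕ} (A : Matrix (Fin m) (Fin n) K) (k : ℕ) : Store K where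
  ints := fun a i =>
    if a = 0 then (if i = 0 then m else if i = 1 then n else if i = 2 then k else 0) else 0
  nums := fun a i j =>
    if h : a = 0 ∧ i < m ∧ j < n then A ⟨i, h.2.1⟩ ⟨j, h.2.2⟩ else 0

/-- The store `σ` holds the pair `S` as output: the integer arrays `1` and `2` flag by the value
`1` the selected rows and columns. -/
def Outputs {K : Type} {m n k : ℕ} (σ : Store K) (S : IndexPair m n k) : Prop :=
  (∀ i : Fin m, i ∈ S.1.1 ↔ σ.ints 1 i = 1) ∧ (∀ j : Fin n, j ∈ S.2.1 ↔ σ.ints 2 j = 1)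

/-- The size of a rational matrix in bits: its dimensions plus the bit lengths of its entries. -/
def inputSize {m n : ℕ} (A : Matrix (Fin m) (Fin n) ℚ) : ℕ :=
  m + n + ∑ i, ∑ j, bitLength (A i j)

end Subdet

/-!
# Complete pivoting finds an almost maximum subdeterminant

The program performs `k` rounds of Gaussian elimination. Each round picks, among the rows and
columns without a pivot, an entry of maximum absolute value as the next pivot. The rows and columns
of the `k` pivots are the output; their minor is, up to sign, the product of the pivots
(`Reach.abs_minor`).

**Approximation.** Let `p` be the pivot of a round and `E`, `E'` the matrices before and after it,
so that `E` is `E'` plus a matrix of rank one. Bordering a submatrix of `E'` by the pivot row and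
column expresses the corresponding minor of `E` of order `l + 1` through one minor of `E'` of order
`l + 1` and `(l + 1) ^ 2` minors of order `l`. As `p` dominates all entries of `E`, and hence `2 p`
all entries of `E'`, the minor is at most `((l + 1) ^ 2 + 2 (l + 1)) |p|` times the maximum minor of
`E'` of order `l` (`abs_det_le_of_eliminate`). After `k` rounds every minor of `A` of order `k` is
at most `(k ^ 2 + 2 k) ^ k` times the product of the pivots, and `k ^ 2 + 2 k ≤ (m + n) ^ 2`
(`Reach.abs_det_le_minor`).

**Bit lengths.** The entries of the reduced matrices are quotients of minors of `A`
(`Reach.exists_det_eq`). With a common denominator of the entries of `A` cleared, numerator and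
denominator are integers with polynomially many bits (`Reach.bitLength_le`).

**The program.** Its analysis is done once, for an arbitrary ordered field and cost model, given a
bound `C` on the cost of each single operation (`exec_completePivoting`); `C` is `1` for the unit
costs and polynomial in the input size for the bit costs. All possible runs of the elimination are
described by the relation `Reach`, which abstracts from the choice among entries of equal absolute
value.
-/

namespace Subdet

/-! ### Complete pivoting -/

section Pivoting

variable {K : Type} [Field K] {m n : ℕ}

/-- The determinant is the product of the upper left entry and of the determinant of its Schur
complement. -/
theorem det_eq_mul_det_schur {l : ℕ} (M : Matrix (Fin (l + 1)) (Fin (l + 1)) K) (h : M 0 0 ≠ 0) :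
    M.det = M 0 0 *
      (Matrix.of fun a b : Fin l => M a.succ b.succ - M a.succ 0 * M 0 b.succ / M 0 0).det := by
  let N : Matrix (Fin (l + 1)) (Fin (l + 1)) K := Matrix.of fun a b =>
    Fin.cases (M 0 b) (fun a' => M a'.succ b - M a'.succ 0 / M 0 0 * M 0 b) a
  have hMN : M.det = N.det := by
    refine Matrix.det_eq_of_forall_row_eq_smul_add_const
      (fun a => Fin.cases 0 (fun a' => M a'.succ 0 / M 0 0) a) 0 rfl fun a b => ?_
    refine Fin.cases ?_ (fun a' => ?_) a <;> simp [N]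
  rw [hMN, Matrix.det_succ_column_zero, Fin.sum_univ_succ, Finset.sum_eq_zero]
  · simp only [Fin.val_zero, pow_zero, one_mul, add_zero]
    congr 2
    ext a b
    simp only [N, Matrix.submatrix_apply, Matrix.of_apply, Fin.cases_succ, Fin.zero_succAbove]
    ring
  · intro a _
    simp [N, h]

/-- One round of Gaussian elimination with pivot `(r, s)`. A zero pivot leaves the matrix
unchanged, since division by `0` returns `0`. -/
def eliminate (E : Matrix (Fin m) (Fin n) K) (r : Fin m) (s : Fin n) : Matrix (Fin m) (Fin n) K :=
  fun a b => E a b - E a s * E r b / E r s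

theorem eliminate_zero (r : Fin m) (s : Fin n) :
    eliminate (0 : Matrix (Fin m) (Fin n) K) r s = 0 := by
  ext a b
  simp [eliminate]

/-- Minors after the elimination are minors before it with the pivot row and column adjoined. A zero
pivot is allowed if the whole matrix is `0`. -/
theorem det_submatrix_cons {E : Matrix (Fin m) (Fin n) K} {r : Fin m} {s : Fin n}
    (h : E r s = 0 → E = 0) {l : ℕ} (f : Fin l → Fin m) (g : Fin l → Fin n) :
    (E.submatrix (Fin.cons r f : Fin (l + 1) → Fin m) (Fin.cons s g : Fin (l + 1) → Fin n)).det =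
      E r s * ((eliminate E r s).submatrix f g).det := by
  by_cases hp : E r s = 0
  · simp [h hp, Matrix.det_zero]
  · rw [det_eq_mul_det_schur _ (by simpa using hp)]
    rfl

theorem image_comp_cast {α : Type*} [DecidableEq α] {a b : ℕ} (e : a = b) (F : Fin b → α) :
    Finset.univ.image (fun x : Fin a => F (x.cast e)) = Finset.univ.image F := by
  subst e
  rfl

variable [LinearOrder K]

/-- `Reach A i E I J D`: some run of `i` rounds of elimination with complete pivoting turns `A` into
`E`, with pivots in the rows `I` and columns `J`, and `D` is the product of the pivots. A pivot is
any entry of maximum absolute value outside the earlier pivot rows and columns. -/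
inductive Reach (A : Matrix (Fin m) (Fin n) K) :
    ℕ → Matrix (Fin m) (Fin n) K → Finset (Fin m) → Finset (Fin n) → K → Prop
  | zero : Reach A 0 A ∅ ∅ 1
  | step {i : ℕ} {E : Matrix (Fin m) (Fin n) K} {I : Finset (Fin m)} {J : Finset (Fin n)} {D : K}
      {r : Fin m} {s : Fin n} (h : Reach A i E I J D) (hr : r ∉ I) (hs : s ∉ J)
      (hmax : ∀ a ∉ I, ∀ b ∉ J, |E a b| ≤ |E r s|) :
      Reach A (i + 1) (eliminate E r s) (insert r I) (insert s J) (D * E r s)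

namespace Reach

variable {A E : Matrix (Fin m) (Fin n) K} {i : ℕ} {I : Finset (Fin m)} {J : Finset (Fin n)} {D : K}

theorem card_rows (h : Reach A i E I J D) : I.card = i := by
  induction h with
  | zero => rfl
  | step h hr hs hmax ih => rw [Finset.card_insert_of_notMem hr, ih]

theorem card_cols (h : Reach A i E I J D) : J.card = i := by
  induction h with
  | zero => rfl
  | step h hr hs hmax ih => rw [Finset.card_insert_of_notMem hs, ih]

variable [IsStrictOrderedRing K]

theorem eq_zero_of_pivot {r : Fin m} {s : Fin n} (hz : ∀ a b, a ∈ I ∨ b ∈ J → E a b = 0)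
    (hmax : ∀ a ∉ I, ∀ b ∉ J, |E a b| ≤ |E r s|) (hp : E r s = 0) : E = 0 := by
  ext a b
  by_cases hab : a ∈ I ∨ b ∈ J
  · exact hz a b hab
  · push Not at hab
    have := hmax a hab.1 b hab.2
    rw [hp, abs_zero] at this
    exact abs_eq_zero.1 (le_antisymm this (abs_nonneg _))

/-- The rows and columns of earlier pivots have been cleared. -/
theorem apply_eq_zero (h : Reach A i E I J D) : ∀ a b, a ∈ I ∨ b ∈ J → E a b = 0 := by
  induction h with
  | zero => simp
  | @step i E I J D r s h hr hs hmax ih =>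
    intro a b hab
    by_cases hp : E r s = 0
    · rw [eq_zero_of_pivot ih hmax hp, eliminate_zero]; rfl
    · simp only [Finset.mem_insert] at hab
      rcases hab with (rfl | ha) | (rfl | hb)
      · simp [eliminate, mul_div_cancel_left₀ _ hp]
      · simp [eliminate, ih a b (.inl ha), ih a s (.inl ha)]
      · simp [eliminate, mul_div_cancel_right₀ _ hp]
      · simp [eliminate, ih a b (.inr hb), ih r b (.inr hb)]

theorem eq_zero_of_prod (h : Reach A i E I J D) (hD : D = 0) : E = 0 := by
  induction h with
  | zero => simp at hD
  | @step i E I J D r s h hr hs hmax ih =>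
    have : E = 0 := by
      rcases mul_eq_zero.1 hD with hD | hp
      · exact ih hD
      · exact eq_zero_of_pivot h.apply_eq_zero hmax hp
    rw [this, eliminate_zero]

theorem abs_le_pivot (h : Reach A i E I J D) {r : Fin m} {s : Fin n}
    (hmax : ∀ a ∉ I, ∀ b ∉ J, |E a b| ≤ |E r s|) (a : Fin m) (b : Fin n) :
    |E a b| ≤ |E r s| := by
  by_cases hab : a ∈ I ∨ b ∈ J
  · rw [h.apply_eq_zero a b hab, abs_zero]
    exact abs_nonneg _
  · push Not at hab
    exact hmax a hab.1 b hab.2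

/-- Minors of the reduced matrix are quotients of minors of the original one. For `l = 0` this says
that the product of the pivots is a minor with rows `I` and columns `J`; for `l = 1` it expresses
the entries of `E`. -/
theorem exists_det_eq (h : Reach A i E I J D) : ∀ {l : ℕ} (f : Fin l → Fin m) (g : Fin l → Fin n),
    ∃ (F : Fin (i + l) → Fin m) (G : Fin (i + l) → Fin n),
      Finset.univ.image F = I ∪ Finset.univ.image f ∧
      Finset.univ.image G = J ∪ Finset.univ.image g ∧
      D * (E.submatrix f g).det = (A.submatrix F G).det := by
  induction h with
  | zero =>
    intro l f g
    refine ⟨fun x => f (x.cast (zero_add l)), fun x => g (x.cast (zero_add l)), ?_, ?_, ?_⟩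
    · rw [image_comp_cast, Finset.empty_union]
    · rw [image_comp_cast, Finset.empty_union]
    · rw [one_mul]
      exact (Matrix.det_submatrix_equiv_self (finCongr (zero_add l)) (A.submatrix f g)).symm
  | @step i E I J D r s h hr hs hmax ih =>
    intro l f g
    -- Adjoin the pivot to the chosen rows and columns before the elimination step.
    obtain ⟨F, G, hF, hG, hd⟩ :=
      ih (Fin.cons r f : Fin (l + 1) → Fin m) (Fin.cons s g : Fin (l + 1) → Fin n)
    have e : i + 1 + l = i + (l + 1) := by omega
    rw [det_submatrix_cons (eq_zero_of_pivot h.apply_eq_zero hmax), ← mul_assoc] at hd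
    refine ⟨fun x => F (x.cast e), fun x => G (x.cast e), ?_, ?_, ?_⟩
    · rw [image_comp_cast, hF]
      ext a
      simp [Fin.exists_fin_succ, eq_comm, or_left_comm]
    · rw [image_comp_cast, hG]
      ext a
      simp [Fin.exists_fin_succ, eq_comm, or_left_comm]
    · rw [hd]
      exact (Matrix.det_submatrix_equiv_self (finCongr e) (A.submatrix F G)).symm

end Reach

/-- An enumeration of `I` is the increasing one up to a permutation. -/
theorem exists_perm_comp_orderEmb {m k : ℕ} {I : Finset (Fin m)} (hI : I.card = k)
    {F : Fin k → Fin m} (hF : Finset.univ.image F = I) :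
    ∃ π : Equiv.Perm (Fin k), F = I.orderEmbOfFin hI ∘ π := by
  have hinj : Function.Injective F := by
    have := Finset.card_image_iff.1 (show (Finset.univ.image F).card = Finset.univ.card by
      rw [hF, hI, Finset.card_univ, Fintype.card_fin])
    simpa [Set.injOn_univ] using this
  have hmem (x : Fin k) : F x ∈ I := hF ▸ Finset.mem_image_of_mem F (Finset.mem_univ x)
  let φ : Fin k → Fin k := fun x => (I.orderIsoOfFin hI).symm ⟨F x, hmem x⟩
  have hφ : Function.Injective φ := fun x y hxy => hinj (by simpa [φ] using hxy)
  refine ⟨Equiv.ofBijective φ (Finite.injective_iff_bijective.1 hφ), ?_⟩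
  ext x
  simp [φ, ← Finset.coe_orderIsoOfFin_apply]

variable [IsStrictOrderedRing K]

theorem Reach.abs_minor {A E : Matrix (Fin m) (Fin n) K} {k : ℕ} {I : Finset (Fin m)}
    {J : Finset (Fin n)} {D : K} (h : Reach A k E I J D) (hI : I.card = k) (hJ : J.card = k) :
    |(A.submatrix (I.orderEmbOfFin hI) (J.orderEmbOfFin hJ)).det| = |D| := by
  obtain ⟨F, G, hF, hG, hd⟩ := h.exists_det_eq (l := 0) Fin.elim0 Fin.elim0
  obtain ⟨π, rfl⟩ := exists_perm_comp_orderEmb hI (by simpa using hF)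
  obtain ⟨ρ, rfl⟩ := exists_perm_comp_orderEmb hJ (by simpa using hG)
  rw [Matrix.det_isEmpty, mul_one] at hd
  rw [hd]
  exact (Matrix.abs_det_submatrix_equiv_equiv π ρ
    (A.submatrix (I.orderEmbOfFin hI) (J.orderEmbOfFin hJ))).symm

theorem abs_det_le_of_row {l : ℕ} (M : Matrix (Fin (l + 1)) (Fin (l + 1)) K) {x B : K}
    (hx : ∀ j, |M 0 j| ≤ x)
    (hB : ∀ j : Fin (l + 1), |(M.submatrix Fin.succ j.succAbove).det| ≤ B) :
    |M.det| ≤ (l + 1) * (x * B) := by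
  have hx0 : 0 ≤ x := (abs_nonneg _).trans (hx 0)
  rw [Matrix.det_succ_row_zero]
  refine (Finset.abs_sum_le_sum_abs _ _).trans ?_
  refine (Finset.sum_le_card_nsmul _ _ (x * B) fun j _ => ?_).trans ?_
  · rw [abs_mul, abs_mul, abs_pow, abs_neg, abs_one, one_pow, one_mul]
    exact mul_le_mul (hx j) (hB j) (abs_nonneg _) hx0
  · simp

/-- If the pivot `E r s` has maximum absolute value, minors of order `l + 1` before the
elimination are controlled by minors of order `l` after it. -/
theorem abs_det_le_of_eliminate {E : Matrix (Fin m) (Fin n) K} {r : Fin m} {s : Fin n}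
    (hmax : ∀ a b, |E a b| ≤ |E r s|) (l : ℕ) {B : K}
    (hB : ∀ (f : Fin l → Fin m) (g : Fin l → Fin n),
      |((eliminate E r s).submatrix f g).det| ≤ B)
    (f : Fin (l + 1) → Fin m) (g : Fin (l + 1) → Fin n) :
    |(E.submatrix f g).det| ≤ ((l + 1) ^ 2 + 2 * (l + 1)) * (|E r s| * B) := by
  by_cases hp : E r s = 0
  · have : E = 0 := by
      ext a b
      have := hmax a b
      rw [hp, abs_zero] at this
      exact abs_eq_zero.1 (le_antisymm this (abs_nonneg _))
    simp [this, Matrix.det_zero]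
  have hp' : 0 < |E r s| := abs_pos.2 hp
  -- Bordering the reduced matrix by the pivot row and column gives a Schur complement
  -- equal to the original submatrix.
  let M : Matrix (Fin (l + 2)) (Fin (l + 2)) K := Matrix.of fun a b =>
    Fin.cases (Fin.cases 1 (fun b' => -(E r (g b') / E r s)) b)
      (fun a' => Fin.cases (E (f a') s) (fun b' => eliminate E r s (f a') (g b')) b) a
  have hM : (E.submatrix f g).det = M.det := by
    rw [det_eq_mul_det_schur M (by simp [M])]
    simp only [M, Matrix.of_apply, Fin.cases_zero, one_mul, Fin.cases_succ]
    congr 1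
    ext a b
    simp only [Matrix.submatrix_apply, Matrix.of_apply, eliminate]
    ring
  have hE (a : Fin m) (b : Fin n) : |eliminate E r s a b| ≤ 2 * |E r s| := by
    have h1 : |E a s * E r b / E r s| ≤ |E r s| := by
      rw [abs_div, abs_mul, div_le_iff₀ hp']
      exact mul_le_mul (hmax a s) (hmax r b) (abs_nonneg _) hp'.le
    calc |eliminate E r s a b| ≤ |E a b| + |E a s * E r b / E r s| := abs_sub _ _
      _ ≤ 2 * |E r s| := by linarith [hmax a b]
  have h0 : |(M.submatrix Fin.succ (Fin.succAbove 0)).det| ≤ (l + 1) * (2 * |E r s| * B) :=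
    abs_det_le_of_row _ (fun j => hE _ _) fun j => hB (f ∘ Fin.succ) (g ∘ j.succAbove)
  have h1 (j : Fin (l + 1)) :
      |(M.submatrix Fin.succ j.succ.succAbove).det| ≤ (l + 1) * (|E r s| * B) := by
    rw [← Matrix.det_transpose]
    refine abs_det_le_of_row _ (fun i => ?_) fun i => ?_
    · simpa [M] using hmax (f i) s
    · rw [← Matrix.det_transpose]
      convert hB (f ∘ i.succAbove) (g ∘ j.succAbove) using 3
      ext a b
      simp [M]
  rw [hM, Matrix.det_succ_row_zero, Fin.sum_univ_succ]
  have h2 : |∑ j : Fin (l + 1), (-1) ^ (j.succ : ℕ) * M 0 j.succ *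
      (M.submatrix Fin.succ j.succ.succAbove).det| ≤ (l + 1) * ((l + 1) * (|E r s| * B)) := by
    refine (Finset.abs_sum_le_sum_abs _ _).trans ?_
    refine (Finset.sum_le_card_nsmul _ _ ((l + 1) * (|E r s| * B)) fun j _ => ?_).trans ?_
    · rw [abs_mul, abs_mul, abs_pow, abs_neg, abs_one, one_pow, one_mul]
      refine le_trans (mul_le_of_le_one_left (abs_nonneg _) ?_) (h1 j)
      simp only [M, Matrix.of_apply, Fin.cases_zero, Fin.cases_succ, abs_neg, abs_div]
      exact div_le_one_of_le₀ (hmax _ _) hp'.le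
    · simp
  refine (abs_add_le _ _).trans ?_
  have h3 : |(-1) ^ ((0 : Fin (l + 2)) : ℕ) * M 0 0 *
      (M.submatrix Fin.succ (Fin.succAbove 0)).det| ≤ (l + 1) * (2 * |E r s| * B) := by
    simpa [M] using h0
  linarith

/-- Minors of `A` of order `k = i + l` are controlled by minors of order `l` after `i` rounds. -/
theorem Reach.abs_det_le {A E : Matrix (Fin m) (Fin n) K} {i : ℕ} {I : Finset (Fin m)}
    {J : Finset (Fin n)} {D : K} (h : Reach A i E I J D) (k : ℕ) :
    ∀ (l : ℕ) (_ : i + l = k) (B : K)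
      (_ : ∀ (f : Fin l → Fin m) (g : Fin l → Fin n), |(E.submatrix f g).det| ≤ B)
      (f : Fin k → Fin m) (g : Fin k → Fin n),
      |(A.submatrix f g).det| ≤ ((k : K) ^ 2 + 2 * k) ^ i * (|D| * B) := by
  induction h with
  | zero =>
    rintro l hl B hB f g
    obtain rfl : l = k := by omega
    simpa using hB f g
  | @step i E I J D r s h hr hs hmax ih =>
    intro l hl B hB f g
    have hle : ((l : K) + 1) ≤ k := by
      have : l + 1 ≤ k := by omega
      exact_mod_cast this
    have hB0 : 0 ≤ B := by
      by_cases hlm : l = 0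
      · subst hlm
        exact (abs_nonneg _).trans (hB Fin.elim0 Fin.elim0)
      · exact (abs_nonneg _).trans (hB (fun _ => r) (fun _ => s))
    refine (ih (l + 1) (by omega) (((k : K) ^ 2 + 2 * k) * (|E r s| * B)) (fun f g => ?_) f g).trans
      (le_of_eq ?_)
    · refine (abs_det_le_of_eliminate (h.abs_le_pivot hmax) l hB f g).trans ?_
      have : (0 : K) ≤ l := Nat.cast_nonneg l
      gcongr
    · rw [abs_mul]
      ring

/-- Complete pivoting selects a subdeterminant of almost maximum absolute value. -/
theorem Reach.abs_det_le_minor {A E : Matrix (Fin m) (Fin n) K} {k : ℕ} {I : Finset (Fin m)}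
    {J : Finset (Fin n)} {D : K} (h : Reach A k E I J D) (hkm : k ≤ m) (hkn : k ≤ n)
    (hI : I.card = k) (hJ : J.card = k)
    (f : Fin k → Fin m) (g : Fin k → Fin n) :
    |(A.submatrix f g).det| ≤ ((n : K) + m) ^ (2 * k) *
      |(A.submatrix (I.orderEmbOfFin hI) (J.orderEmbOfFin hJ)).det| := by
  rw [h.abs_minor hI hJ]
  refine (h.abs_det_le k 0 rfl 1 (by simp) f g).trans ?_
  rw [mul_one, pow_mul]
  have hnat : k ^ 2 + 2 * k ≤ (n + m) ^ 2 := by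
    rcases Nat.eq_zero_or_pos k with rfl | hk
    · simp
    · nlinarith
  have : (k : K) ^ 2 + 2 * k ≤ ((n : K) + m) ^ 2 := by exact_mod_cast hnat
  gcongr

end Pivoting

/-! ### Bit lengths -/

theorem bitLength_zero : bitLength 0 = 2 := by
  simp [bitLength]

theorem bitLength_div_le (x y : ℤ) (hy : y ≠ 0) :
    bitLength (x / y) ≤ Nat.size x.natAbs + Nat.size y.natAbs + 1 := by
  by_cases hx : x = 0
  · subst hx
    have : 1 ≤ Nat.size y.natAbs := Nat.size_pos.2 (Int.natAbs_pos.2 hy)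
    simp [bitLength_zero]
    omega
  · have h1 : ((x : ℚ) / y).num.natAbs ≤ x.natAbs :=
      Nat.le_of_dvd (Int.natAbs_pos.2 hx) (Int.natAbs_dvd_natAbs.2 (by
        rw [← Rat.divInt_eq_div]
        exact Rat.num_dvd x hy))
    have h2 : ((x : ℚ) / y).den ≤ y.natAbs :=
      Nat.le_of_dvd (Int.natAbs_pos.2 hy) (by
        have := Rat.den_dvd x y
        rw [Rat.divInt_eq_div] at this
        simpa using Int.natAbs_dvd_natAbs.2 this)
    unfold bitLength
    have := Nat.size_le_size h1
    have := Nat.size_le_size h2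
    omega

theorem size_mul_le (a b : ℕ) : Nat.size (a * b) ≤ Nat.size a + Nat.size b := by
  rw [Nat.size_le, pow_add]
  exact Nat.mul_lt_mul'' (Nat.lt_size_self a) (Nat.lt_size_self b)

theorem bitLength_mul_le (x y : ℚ) : bitLength (x * y) ≤ bitLength x + bitLength y := by
  have h : x * y = ((x.num * y.num : ℤ) : ℚ) / ((x.den * y.den : ℤ) : ℚ) := by
    push_cast
    rw [mul_div_mul_comm, Rat.num_div_den, Rat.num_div_den]
  rw [h]
  refine (bitLength_div_le _ _ (by simp)).trans ?_
  have h1 := size_mul_le x.num.natAbs y.num.natAbs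
  have h2 := size_mul_le x.den y.den
  simp only [Int.natAbs_mul, Int.natAbs_natCast, bitLength]
  omega

theorem bitLength_inv (x : ℚ) : bitLength x⁻¹ ≤ bitLength x + 1 := by
  by_cases hx : x = 0
  · simp [hx]
  · have h : x⁻¹ = ((x.den : ℤ) : ℚ) / (x.num : ℚ) := by
      conv_lhs => rw [← Rat.num_div_den x]
      rw [inv_div]; rfl
    rw [h]
    refine (bitLength_div_le _ _ (by simpa using hx)).trans ?_
    simp only [Int.natAbs_natCast, bitLength]
    omega

theorem bitLength_div_le_add (x y : ℚ) : bitLength (x / y) ≤ bitLength x + bitLength y + 1 := by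
  rw [div_eq_mul_inv]
  have := bitLength_mul_le x y⁻¹
  have := bitLength_inv y
  omega

theorem bitLength_div_le_of_abs_le (x y : ℤ) (hy : y ≠ 0) {b : ℕ} (hx : |x| ≤ 2 ^ b)
    (hyb : |y| ≤ 2 ^ b) : bitLength (x / y) ≤ 2 * b + 3 := by
  have size_le (z : ℤ) (hz : |z| ≤ 2 ^ b) : Nat.size z.natAbs ≤ b + 1 := by
    rw [Nat.size_le]
    have : z.natAbs ≤ 2 ^ b := by
      zify
      exact hz
    exact this.trans_lt (Nat.pow_lt_pow_right (by norm_num) (by omega))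
  have := bitLength_div_le x y hy
  have := size_le x hx
  have := size_le y hyb
  omega

section Rational

variable {m n : ℕ} (A : Matrix (Fin m) (Fin n) ℚ)

/-- A common denominator of the entries. -/
def commonDen : ℕ := ∏ i, ∏ j, (A i j).den

theorem commonDen_pos : 0 < commonDen A :=
  Finset.prod_pos fun _ _ => Finset.prod_pos fun _ _ => Rat.den_pos _

theorem bitLength_le_inputSize (i : Fin m) (j : Fin n) : bitLength (A i j) ≤ inputSize A := by
  have h1 : bitLength (A i j) ≤ ∑ j, bitLength (A i j) :=
    Finset.single_le_sum (f := fun j => bitLength (A i j)) (fun _ _ => Nat.zero_le _)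
      (Finset.mem_univ j)
  have h2 : ∑ j, bitLength (A i j) ≤ ∑ i, ∑ j, bitLength (A i j) :=
    Finset.single_le_sum (f := fun i => ∑ j, bitLength (A i j)) (fun _ _ => Nat.zero_le _)
      (Finset.mem_univ i)
  unfold inputSize
  omega

theorem commonDen_le : commonDen A ≤ 2 ^ inputSize A := by
  calc commonDen A ≤ ∏ i, ∏ j, 2 ^ bitLength (A i j) := by
        unfold commonDen
        gcongr with i _ j _
        refine (Nat.lt_size_self _).le.trans (Nat.pow_le_pow_right (by norm_num) ?_)
        unfold bitLength
        omega
    _ = 2 ^ ∑ i, ∑ j, bitLength (A i j) := by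
        simp_rw [Finset.prod_pow_eq_pow_sum]
    _ ≤ 2 ^ inputSize A := Nat.pow_le_pow_right (by norm_num) (by unfold inputSize; omega)

theorem exists_int_entry (i : Fin m) (j : Fin n) :
    ∃ z : ℤ, (commonDen A : ℚ) * A i j = z ∧ |z| ≤ 2 ^ (2 * inputSize A) := by
  have hd : (A i j).den ∣ commonDen A :=
    (Finset.dvd_prod_of_mem (fun j => (A i j).den) (Finset.mem_univ j)).trans
      (Finset.dvd_prod_of_mem (fun i => ∏ j, (A i j).den) (Finset.mem_univ i))
  obtain ⟨w, hw⟩ := hd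
  refine ⟨w * (A i j).num, ?_, ?_⟩
  · rw [hw]
    push_cast
    have := Rat.den_mul_eq_num (A i j)
    linear_combination (w : ℚ) * this
  · rw [abs_mul, two_mul, pow_add]
    have h1 : |(w : ℤ)| ≤ 2 ^ inputSize A := by
      rw [Nat.abs_cast]
      have : w ≤ commonDen A := by
        rw [hw]
        exact Nat.le_mul_of_pos_left _ (Rat.den_pos _)
      exact_mod_cast this.trans (commonDen_le A)
    have h2 : |(A i j).num| ≤ 2 ^ inputSize A := by
      have : (A i j).num.natAbs ≤ 2 ^ inputSize A := by
        refine (Nat.lt_size_self _).le.trans (Nat.pow_le_pow_right (by norm_num) ?_)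
        refine le_trans ?_ (bitLength_le_inputSize A i j)
        unfold bitLength
        omega
      zify at this
      exact this
    exact mul_le_mul h1 h2 (abs_nonneg _) (by positivity)

theorem exists_int_det {s : ℕ} (F : Fin s → Fin m) (G : Fin s → Fin n) :
    ∃ z : ℤ, (commonDen A : ℚ) ^ s * (A.submatrix F G).det = z ∧
      |z| ≤ 2 ^ (s * (s + 2 * inputSize A)) := by
  choose Z hZ hZb using exists_int_entry A
  refine ⟨(Matrix.det (Matrix.of fun a b : Fin s => Z (F a) (G b))), ?_, ?_⟩
  · have := Matrix.det_smul (A.submatrix F G) (commonDen A : ℚ)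
    rw [Fintype.card_fin] at this
    rw [← this, Int.cast_det]
    congr 1
    ext a b
    simp [← hZ]
  · refine (Matrix.det_le (abv := AbsoluteValue.abs) (x := 2 ^ (2 * inputSize A))
      (fun a b => hZb _ _)).trans ?_
    rw [Fintype.card_fin, nsmul_eq_mul, mul_add, pow_add, ← pow_mul, mul_comm s (2 * _)]
    gcongr
    have h1 : s.factorial ≤ s ^ s := Nat.factorial_le_pow s
    have h2 : s ^ s ≤ (2 ^ s) ^ s := Nat.pow_le_pow_left Nat.lt_two_pow_self.le s
    rw [← pow_mul] at h2
    exact_mod_cast h1.trans h2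

/-- A bound on the bit length of the entries of the reduced matrices of a matrix of size `L`:
these are quotients of integers of absolute value at most `2 ^ ((L + 1) * (3 * L + 1) + L)`. -/
def entryBound (L : ℕ) : ℕ := 2 * ((L + 1) * (3 * L + 1) + L) + 3

variable {A}

theorem Reach.bitLength_le {E : Matrix (Fin m) (Fin n) ℚ} {i : ℕ} {I : Finset (Fin m)}
    {J : Finset (Fin n)} {D : ℚ} (h : Reach A i E I J D) (a : Fin m) (b : Fin n) :
    bitLength (E a b) ≤ entryBound (inputSize A) := by
  have hi : i ≤ inputSize A := by
    have h1 := h.card_rows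
    have h2 := Finset.card_le_univ I
    rw [Fintype.card_fin] at h2
    unfold inputSize
    omega
  by_cases hD : D = 0
  · rw [h.eq_zero_of_prod hD, Matrix.zero_apply, bitLength_zero]
    unfold entryBound
    omega
  obtain ⟨F, G, -, -, hd1⟩ := h.exists_det_eq (l := 1) (fun _ => a) (fun _ => b)
  obtain ⟨F', G', -, -, hd0⟩ := h.exists_det_eq (l := 0) Fin.elim0 Fin.elim0
  rw [Matrix.det_isEmpty, mul_one] at hd0
  rw [Matrix.det_fin_one, Matrix.submatrix_apply] at hd1
  obtain ⟨z, hz, hzb⟩ := exists_int_det A F G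
  obtain ⟨w, hw, hwb⟩ := exists_int_det A F' G'
  rw [← hd1] at hz
  rw [← hd0] at hw
  have hΔ : (commonDen A : ℚ) ≠ 0 := by exact_mod_cast (commonDen_pos A).ne'
  have hw0 : w ≠ 0 := by
    rintro rfl
    simp [hΔ, hD] at hw
  have hE : E a b = (z : ℚ) / ((w * commonDen A : ℤ) : ℚ) := by
    push_cast
    rw [← hz, ← hw]
    field_simp
    ring
  have pow_le {s : ℕ} (hs : s ≤ inputSize A + 1) : s * (s + 2 * inputSize A) ≤
      (inputSize A + 1) * (3 * inputSize A + 1) := Nat.mul_le_mul hs (by omega)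
  rw [hE]
  refine bitLength_div_le_of_abs_le _ _ ?_ (hzb.trans ?_) ?_
  · exact mul_ne_zero hw0 (by exact_mod_cast (commonDen_pos A).ne')
  · refine pow_le_pow_right₀ (by norm_num) ?_
    have := @pow_le (i + 1) (by omega)
    omega
  · rw [abs_mul, pow_add, Nat.abs_cast]
    refine mul_le_mul (hwb.trans (pow_le_pow_right₀ (by norm_num) (pow_le (by omega)))) ?_
      (by positivity) (by positivity)
    exact_mod_cast commonDen_le A

end Rational

/-! ### Running times of loops -/

/-- Started in a store satisfying `Pre`, the program halts at cost at most `T` in a store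
satisfying `Post`. -/
def Spec {K : Type} [Field K] [LinearOrder K] (M : CostModel K) (Pre : Store K → Prop) (P : Prog)
    (T : ℕ) (Post : Store K → Prop) : Prop :=
  ∀ σ, Pre σ → ∃ t τ, Exec M P σ t τ ∧ t ≤ T ∧ Post τ

/-- The scratch variable number `x`. -/
def var (x : ℕ) : IExp := .get 3 (.lit x)

/-- Run `body` with variable `x` counting up from `0` while it is less than cell `y` of integer
array `0`. -/
def forLoop (x y : ℕ) (body : Prog) : Prog :=
  .seq (.setInt 3 (.lit x) (.lit 0))
    (.loop (.ilt (var x) (.get 0 (.lit y)))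
      (.seq body (.setInt 3 (.lit x) (.add (var x) (.lit 1)))))

/-- Run `body` once for every matrix cell, whose row and column are in the variables `1` and
`2`. -/
def forCells (body : Prog) : Prog := forLoop 1 0 (forLoop 2 1 body)

section Loops

variable {K : Type} [Field K] [LinearOrder K] {M : CostModel K} {C m n s : ℕ}

/-- The loop rule: the body preserves the invariant `Inv` and costs at most `T` per run, and the
invariant ignores the loop variable. -/
theorem spec_forLoop {x y N T : ℕ} {body : Prog} (Inv : ℕ → Store K → Prop)
    (hint : ∀ c ≤ s, M.int c ≤ C) (h1 : 1 ≤ s) (hx : x ≤ s) (hy : y ≤ s) (hN : N ≤ s)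
    (hstable : ∀ j σ v, Inv j σ → Inv j (σ.writeInt 3 x v))
    (hbound : ∀ j σ, Inv j σ → σ.ints 0 y = N)
    (hbody : ∀ j < N, Spec M (fun σ => Inv j σ ∧ σ.ints 3 x = j) body T
      (fun σ => Inv (j + 1) σ ∧ σ.ints 3 x = j)) :
    Spec M (Inv 0) (forLoop x y body) ((N + 1) * (T + 9 * C + 2)) (Inv N) := by
  have hx' := hint x hx
  have hy' := hint y hy
  have hN' := hint N hN
  have hone := hint 1 h1
  have hzero := hint 0 (Nat.zero_le _)
  have key : ∀ d j, j + d = N → Spec M (fun σ => Inv j σ ∧ σ.ints 3 x = j)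
      (.loop (.ilt (var x) (.get 0 (.lit y)))
        (.seq body (.setInt 3 (.lit x) (.add (var x) (.lit 1)))))
      (d * (T + 9 * C + 2) + (4 * C + 1)) (Inv N) := by
    intro d
    induction d with
    | zero =>
      rintro j hj σ ⟨hσ, hσx⟩
      obtain rfl : j = N := by omega
      have hb := hbound _ _ hσ
      refine ⟨_, σ, .loop_false ?_, ?_, hσ⟩
      · simp [Test.Holds, var, IExp.eval, hσx, hb]
      · simp only [Test.cost, var, IExp.cost, IExp.eval, hσx, hb]
        omega
    | succ d ih =>
      rintro j hj σ ⟨hσ, hσx⟩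
      have hb := hbound _ _ hσ
      have hj' := hint j (by omega)
      have hj1 := hint (j + 1) (by omega)
      obtain ⟨t, τ, hE, ht, hτ, hτx⟩ := hbody j (by omega) σ ⟨hσ, hσx⟩
      obtain ⟨u, υ, hL, hu, hυ⟩ := ih (j + 1) (by omega) (τ.writeInt 3 x (j + 1))
        ⟨hstable _ _ _ hτ, by simp [Store.writeInt]⟩
      have hinc := Exec.setInt (M := M) τ 3 (.lit x) (.add (var x) (.lit 1))
      simp only [var, IExp.eval, hτx] at hinc
      refine ⟨_, υ, .loop_true ?_ (.seq hE hinc) hL, ?_, hυ⟩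
      · simp [Test.Holds, var, IExp.eval, hσx, hb]
        omega
      · simp only [Test.cost, var, IExp.cost, IExp.eval, hσx, hb, hτx]
        rw [Nat.succ_mul]
        omega
  intro σ hσ
  obtain ⟨u, υ, hL, hu, hυ⟩ := key N 0 (by omega) (σ.writeInt 3 x 0)
    ⟨hstable _ _ _ hσ, by simp [Store.writeInt]⟩
  refine ⟨_, υ, .seq (.setInt σ 3 (.lit x) (.lit 0)) hL, ?_, hυ⟩
  simp only [IExp.cost]
  rw [Nat.succ_mul]
  omega

theorem spec_forCells {T : ℕ} {body : Prog} (Inv : ℕ → ℕ → Store K → Prop)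
    (hint : ∀ c ≤ s, M.int c ≤ C) (h2 : 2 ≤ s) (hm : m ≤ s) (hn : n ≤ s)
    (hstable : ∀ a b σ v x, x = 1 ∨ x = 2 → Inv a b σ → Inv a b (σ.writeInt 3 x v))
    (hrows : ∀ a b σ, Inv a b σ → σ.ints 0 0 = m)
    (hcols : ∀ a b σ, Inv a b σ → σ.ints 0 1 = n)
    (hnext : ∀ a σ, Inv a n σ → Inv (a + 1) 0 σ)
    (hbody : ∀ a < m, ∀ b < n, Spec M (fun σ => Inv a b σ ∧ σ.ints 3 1 = a ∧ σ.ints 3 2 = b) body T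
      (fun σ => Inv a (b + 1) σ ∧ σ.ints 3 1 = a ∧ σ.ints 3 2 = b)) :
    Spec M (Inv 0 0) (forCells body) ((m + 1) * ((n + 1) * (T + 9 * C + 2) + 9 * C + 2))
      (Inv m 0) := by
  refine spec_forLoop (fun a => Inv a 0) hint (by omega) (by omega) (by omega) hm
    (fun a σ v h => hstable _ _ _ _ _ (.inl rfl) h) (fun a σ h => hrows _ _ _ h) fun a ha => ?_
  have := spec_forLoop (M := M) (x := 2) (y := 1) (N := n) (T := T) (body := body)
    (fun b σ => Inv a b σ ∧ σ.ints 3 1 = a) hint (by omega) (by omega) (by omega) hn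
    (fun b σ v h => ⟨hstable _ _ _ _ _ (.inr rfl) h.1, by simpa [Store.writeInt] using h.2⟩)
    (fun b σ h => hcols _ _ _ h.1) (fun b hb σ h => ?_)
  · intro σ hσ
    obtain ⟨t, τ, hE, ht, hτ, hτ1⟩ := this σ hσ
    exact ⟨t, τ, hE, ht, hnext _ _ hτ, hτ1⟩
  · obtain ⟨t, τ, hE, ht, h1, h2, h3⟩ := hbody a ha b hb σ ⟨h.1.1, h.1.2, h.2⟩
    exact ⟨t, τ, hE, ht, ⟨h1, h2⟩, h3⟩

end Loops

/-! ### The program -/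

/-- Neither the current row nor the current column contains an earlier pivot. -/
def isFree : Test :=
  .and (.ilt (.get 1 (var 1)) (.lit 1)) (.ilt (.get 2 (var 2)) (.lit 1))

/-- The entry in the current cell. -/
def cell : NExp := .get 0 (var 1) (var 2)

/-- The best pivot candidate so far, whose row and column are in the variables `3` and `4`. -/
def best : NExp := .get 1 (.lit 0) (.lit 0)

/-- Make the current cell the pivot candidate if it is free and at least as large as the previous
one. Absolute values are compared through squares. -/
def scanCell : Prog :=
  .branch isFree
    (.branch (.not (.nlt (.mul cell cell) (.mul best best)))
      (.seq (.setInt 3 (.lit 3) (var 1))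
        (.seq (.setInt 3 (.lit 4) (var 2)) (.setNum 1 (.lit 0) (.lit 0) cell)))
      .skip)
    .skip

/-- Update the current cell by elimination if it is free. Pivot rows and columns keep their old
entries, so that the elimination can be done in place. -/
def elimCell : Prog :=
  .branch isFree
    (.setNum 0 (var 1) (var 2)
      (.sub cell (.div (.mul (.get 0 (var 1) (var 4)) (.get 0 (var 3) (var 2)))
        (.get 0 (var 3) (var 4)))))
    .skip

/-- Choose a pivot and eliminate. -/
def pivotRound : Prog :=
  .seq (.setNum 1 (.lit 0) (.lit 0) (.lit 0))
    (.seq (forCells scanCell)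
      (.seq (.seq (.setInt 1 (var 3) (.lit 1)) (.setInt 2 (var 4) (.lit 1)))
        (forCells elimCell)))

/-- Perform `k` rounds. The pivots are not stored separately: the flags of their rows and columns in
the integer arrays `1` and `2` are the output. -/
def completePivoting : Prog := forLoop 0 2 pivotRound

/-! ### Correctness of the program -/

section Correctness

variable {K : Type} [Field K] {m n k : ℕ}

/-- The store `σ` represents the matrix `E` with earlier pivots in the rows `I` and columns `J`;
only entries outside these rows and columns are represented. -/
structure Models (k : ℕ) (E : Matrix (Fin m) (Fin n) K) (I : Finset (Fin m)) (J : Finset (Fin n))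
    (σ : Store K) : Prop where
  m_eq : σ.ints 0 0 = m
  n_eq : σ.ints 0 1 = n
  k_eq : σ.ints 0 2 = k
  rows : ∀ a : Fin m, σ.ints 1 a = if a ∈ I then 1 else 0
  cols : ∀ b : Fin n, σ.ints 2 b = if b ∈ J then 1 else 0
  entries : ∀ a ∉ I, ∀ b ∉ J, σ.nums 0 a b = E a b

/-- The cell `(a', b')` is visited before the cell `(a, b)`. -/
def Seen (a b a' b' : ℕ) : Prop := a' < a ∨ a' = a ∧ b' < b

instance (a b a' b' : ℕ) : Decidable (Seen a b a' b') :=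
  inferInstanceAs (Decidable (_ ∨ _))

theorem seen_row_end {a a' : ℕ} {b' : Fin n} : Seen a n a' b' ↔ Seen (a + 1) 0 a' b' := by
  have := b'.2
  unfold Seen
  omega

theorem seen_succ {a b a' b' : ℕ} : Seen a (b + 1) a' b' ↔ Seen a b a' b' ∨ (a' = a ∧ b' = b) := by
  unfold Seen
  omega

theorem seen_all (a : Fin m) (b : ℕ) : Seen m 0 a b := .inl a.2

theorem not_seen_zero (a b : ℕ) : ¬ Seen 0 0 a b := by
  unfold Seen
  omega

theorem not_seen_self (a b : ℕ) : ¬ Seen a b a b := by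
  unfold Seen
  omega

/-- All numbers used when eliminating in `E`, except the new entries, cost at most `C`. -/
structure Charged (M : CostModel K) (C : ℕ) (E : Matrix (Fin m) (Fin n) K) : Prop where
  entry : ∀ a b, M.num (E a b) ≤ C
  mul : ∀ a b a' b', M.num (E a b * E a' b') ≤ C
  div : ∀ a b a' b' r s, M.num (E a b * E a' b' / E r s) ≤ C

theorem isFree_cost {E : Matrix (Fin m) (Fin n) K} {I : Finset (Fin m)} {J : Finset (Fin n)}
    {σ : Store K} {M : CostModel K} {C : ℕ} (hint : ∀ c ≤ m + n + 4, M.int c ≤ C)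
    (h : Models k E I J σ) {a : Fin m} {b : Fin n} (ha : σ.ints 3 1 = a)
    (hb : σ.ints 3 2 = b) : isFree.cost M σ ≤ 8 * C + 3 := by
  have h0 := hint 0 (by omega)
  have h1 := hint 1 (by omega)
  have h2 := hint 2 (by omega)
  have h3 := hint a (by omega)
  have h4 := hint b (by omega)
  simp only [isFree, Test.cost, var, IExp.cost, IExp.eval, ha, hb, h.rows, h.cols]
  split_ifs <;> omega

variable [LinearOrder K]

/-- The variables `3` and `4` hold a cell outside the earlier pivot rows and columns, and the best
value so far is the entry of that cell. -/
def Found (E : Matrix (Fin m) (Fin n) K) (I : Finset (Fin m)) (J : Finset (Fin n)) (σ : Store K) :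
    Prop :=
  ∃ r ∉ I, ∃ s ∉ J, σ.ints 3 3 = r ∧ σ.ints 3 4 = s ∧ σ.nums 1 0 0 = E r s

/-- The state of the pivot search when it reaches the cell `(a, b)` in round `i`. The best value
starts at `0`, which does not count as found, so that a pivot is chosen even if all entries are
`0`. -/
structure ScanInv (k i : ℕ) (E : Matrix (Fin m) (Fin n) K) (I : Finset (Fin m))
    (J : Finset (Fin n)) (a b : ℕ) (σ : Store K) : Prop where
  models : Models k E I J σ
  counter : σ.ints 3 0 = i
  start : σ.nums 1 0 0 = 0 ∨ Found E I J σ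
  max : ∀ (a' : Fin m) (b' : Fin n), Seen a b a' b' → a' ∉ I → b' ∉ J →
    |E a' b'| ≤ |σ.nums 1 0 0| ∧ Found E I J σ

/-- The state of the elimination with pivot `(r, s)` when it reaches the cell `(a, b)` in round
`i`. The last two fields record that the row and column of the pivot, from which the updates are
computed, are not overwritten. -/
structure ElimInv (k i : ℕ) (E : Matrix (Fin m) (Fin n) K) (I : Finset (Fin m))
    (J : Finset (Fin n)) (r : Fin m) (s : Fin n) (a b : ℕ) (σ : Store K) : Prop where
  models : Models k (Matrix.of fun a' b' => if a' ≠ r ∧ b' ≠ s ∧ Seen a b a' b' then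
    eliminate E r s a' b' else E a' b') (insert r I) (insert s J) σ
  counter : σ.ints 3 0 = i
  row : σ.ints 3 3 = r
  col : σ.ints 3 4 = s
  pivot_row : ∀ b' ∉ J, σ.nums 0 r b' = E r b'
  pivot_col : ∀ a' ∉ I, σ.nums 0 a' s = E a' s

theorem isFree_holds {E : Matrix (Fin m) (Fin n) K} {I : Finset (Fin m)} {J : Finset (Fin n)}
    {σ : Store K} (h : Models k E I J σ) {a : Fin m} {b : Fin n} (ha : σ.ints 3 1 = a)
    (hb : σ.ints 3 2 = b) : isFree.Holds σ ↔ a ∉ I ∧ b ∉ J := by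
  simp only [isFree, Test.Holds, var, IExp.eval, ha, hb, h.rows, h.cols]
  split_ifs <;> simp [*]

variable {M : CostModel K} {C i : ℕ} {E : Matrix (Fin m) (Fin n) K} {I : Finset (Fin m)}
  {J : Finset (Fin n)}

theorem spec_scanCell [IsStrictOrderedRing K] (hint : ∀ c ≤ m + n + 4, M.int c ≤ C)
    (hzero : M.num 0 ≤ C) (hE : Charged M C E) (a : ℕ) (ha : a < m) (b : ℕ) (hb : b < n) :
    Spec M (fun σ => ScanInv k i E I J a b σ ∧ σ.ints 3 1 = a ∧ σ.ints 3 2 = b) scanCell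
      (40 * C + 10)
      (fun σ => ScanInv k i E I J a (b + 1) σ ∧ σ.ints 3 1 = a ∧ σ.ints 3 2 = b) := by
  rintro σ ⟨h, hσa, hσb⟩
  have hfree := isFree_holds h.models (a := ⟨a, ha⟩) (b := ⟨b, hb⟩) hσa hσb
  have hcost := isFree_cost hint h.models (a := ⟨a, ha⟩) (b := ⟨b, hb⟩) hσa hσb
  have eq_of {a' : Fin m} {b' : Fin n} (h1 : (a' : ℕ) = a) (h2 : (b' : ℕ) = b) :
      a' = ⟨a, ha⟩ ∧ b' = ⟨b, hb⟩ := ⟨Fin.ext h1, Fin.ext h2⟩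
  by_cases hf : isFree.Holds σ
  · obtain ⟨hI, hJ⟩ := hfree.1 hf
    have hcell : σ.nums 0 a b = E ⟨a, ha⟩ ⟨b, hb⟩ := h.models.entries _ hI _ hJ
    have i0 := hint 0 (by omega)
    have i1 := hint 1 (by omega)
    have i2 := hint 2 (by omega)
    have i3 := hint 3 (by omega)
    have i4 := hint 4 (by omega)
    have ia := hint a (by omega)
    have ib := hint b (by omega)
    have c1 := hE.entry ⟨a, ha⟩ ⟨b, hb⟩
    have c2 := hE.mul ⟨a, ha⟩ ⟨b, hb⟩ ⟨a, ha⟩ ⟨b, hb⟩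
    have c3 : M.num (σ.nums 1 0 0) ≤ C ∧ M.num (σ.nums 1 0 0 * σ.nums 1 0 0) ≤ C := by
      rcases h.start with h0 | ⟨r, hr, s, hs, -, -, h0⟩
      · rw [h0, mul_zero]
        exact ⟨hzero, hzero⟩
      · rw [h0]
        exact ⟨hE.entry _ _, hE.mul _ _ _ _⟩
    have hlt : Test.Holds σ (.not (.nlt (.mul cell cell) (.mul best best))) ↔
        |σ.nums 1 0 0| ≤ |E ⟨a, ha⟩ ⟨b, hb⟩| := by
      simp only [Test.Holds, NExp.eval, cell, best, var, IExp.eval, hσa, hσb, hcell, not_lt]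
      exact abs_le_iff_mul_self_le.symm
    by_cases hc : |σ.nums 1 0 0| ≤ |E ⟨a, ha⟩ ⟨b, hb⟩|
    · have hset1 := Exec.setInt (M := M) σ 3 (.lit 3) (var 1)
      simp only [var, IExp.eval, IExp.cost, hσa] at hset1
      have hset2 := Exec.setInt (M := M) (σ.writeInt 3 3 a) 3 (.lit 4) (var 2)
      have hσb' : (σ.writeInt 3 3 a).ints 3 2 = b := by simpa [Store.writeInt] using hσb
      simp only [var, IExp.eval, IExp.cost, hσb'] at hset2
      have hset3 := Exec.setNum (M := M) ((σ.writeInt 3 3 a).writeInt 3 4 b) 1 (.lit 0) (.lit 0)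
        cell
      have hτa : ((σ.writeInt 3 3 a).writeInt 3 4 b).ints 3 1 = a := by
        simpa [Store.writeInt] using hσa
      have hτb : ((σ.writeInt 3 3 a).writeInt 3 4 b).ints 3 2 = b := by
        simpa [Store.writeInt] using hσb
      have hτcell : ((σ.writeInt 3 3 a).writeInt 3 4 b).nums 0 a b = E ⟨a, ha⟩ ⟨b, hb⟩ := hcell
      simp only [cell, NExp.eval, NExp.cost, var, IExp.eval, IExp.cost, hτa, hτb, hτcell] at hset3
      have hfound : Found E I J
          (((σ.writeInt 3 3 a).writeInt 3 4 b).writeNum 1 0 0 (E ⟨a, ha⟩ ⟨b, hb⟩)) :=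
        ⟨⟨a, ha⟩, hI, ⟨b, hb⟩, hJ, by simp [Store.writeInt, Store.writeNum],
          by simp [Store.writeInt, Store.writeNum], by simp [Store.writeNum]⟩
      refine ⟨_, _, .branch_true hf (.branch_true (hlt.2 hc) (.seq hset1 (.seq hset2 hset3))), ?_,
        ⟨⟨h.models.m_eq, h.models.n_eq, h.models.k_eq, h.models.rows, h.models.cols, ?_⟩,
          ?_, .inr hfound, fun a' b' hs ha' hb' => ⟨?_, hfound⟩⟩, hτa, hτb⟩
      · simp only [Test.cost, NExp.cost, NExp.eval, cell, best, var, IExp.cost, IExp.eval, hσa, hσb,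
          hcell]
        omega
      · intro a' ha' b' hb'
        simpa [Store.writeNum, Store.writeInt] using h.models.entries a' ha' b' hb'
      · simpa [Store.writeInt, Store.writeNum] using h.counter
      · have hnew : (((σ.writeInt 3 3 a).writeInt 3 4 b).writeNum 1 0 0
            (E ⟨a, ha⟩ ⟨b, hb⟩)).nums 1 0 0 = E ⟨a, ha⟩ ⟨b, hb⟩ := by simp [Store.writeNum]
        rw [hnew]
        rcases seen_succ.1 hs with hs | ⟨h1, h2⟩
        · exact (h.max a' b' hs ha' hb').1.trans hc
        · obtain ⟨rfl, rfl⟩ := eq_of h1 h2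
          exact le_rfl
    · refine ⟨_, σ, .branch_true hf (.branch_false (fun hc' => hc (hlt.1 hc')) (.skip σ)), ?_,
        ⟨h.models, h.counter, h.start, fun a' b' hs ha' hb' => ?_⟩, hσa, hσb⟩
      · simp only [Test.cost, NExp.cost, NExp.eval, cell, best, var, IExp.cost, IExp.eval, hσa, hσb,
          hcell]
        omega
      · rcases seen_succ.1 hs with hs | ⟨h1, h2⟩
        · exact h.max a' b' hs ha' hb'
        · obtain ⟨rfl, rfl⟩ := eq_of h1 h2
          refine ⟨(not_le.1 hc).le, h.start.resolve_left fun h0 => hc ?_⟩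
          rw [h0, abs_zero]
          exact abs_nonneg _
  · refine ⟨_, σ, .branch_false hf (.skip σ), by omega,
      ⟨h.models, h.counter, h.start, fun a' b' hs ha' hb' => ?_⟩, hσa, hσb⟩
    rcases seen_succ.1 hs with hs | ⟨h1, h2⟩
    · exact h.max a' b' hs ha' hb'
    · obtain ⟨rfl, rfl⟩ := eq_of h1 h2
      exact absurd (hfree.2 ⟨ha', hb'⟩) hf

theorem spec_elimCell (hint : ∀ c ≤ m + n + 4, M.int c ≤ C) {r : Fin m} {s : Fin n}
    (hs : s ∉ J) (hE : Charged M C E) (hE' : ∀ a b, M.num (eliminate E r s a b) ≤ C)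
    (a : ℕ) (ha : a < m) (b : ℕ) (hb : b < n) :
    Spec M (fun σ => ElimInv k i E I J r s a b σ ∧ σ.ints 3 1 = a ∧ σ.ints 3 2 = b) elimCell
      (40 * C + 10)
      (fun σ => ElimInv k i E I J r s a (b + 1) σ ∧ σ.ints 3 1 = a ∧ σ.ints 3 2 = b) := by
  rintro σ ⟨h, hσa, hσb⟩
  have hfree := isFree_holds h.models (a := ⟨a, ha⟩) (b := ⟨b, hb⟩) hσa hσb
  have hcost := isFree_cost hint h.models (a := ⟨a, ha⟩) (b := ⟨b, hb⟩) hσa hσb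
  have eq_of {a' : Fin m} {b' : Fin n} (h1 : (a' : ℕ) = a) (h2 : (b' : ℕ) = b) :
      a' = ⟨a, ha⟩ ∧ b' = ⟨b, hb⟩ := ⟨Fin.ext h1, Fin.ext h2⟩
  by_cases hf : isFree.Holds σ
  · obtain ⟨hI, hJ⟩ := hfree.1 hf
    have hcell : σ.nums 0 a b = E ⟨a, ha⟩ ⟨b, hb⟩ := by
      have := h.models.entries _ hI _ hJ
      simpa [not_seen_self] using this
    have hp : σ.nums 0 r s = E r s := h.pivot_row s hs
    have hI' := hI
    have hJ' := hJ
    rw [Finset.mem_insert, not_or] at hI' hJ'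
    have hrow : σ.nums 0 r b = E r ⟨b, hb⟩ := h.pivot_row ⟨b, hb⟩ hJ'.2
    have hcol : σ.nums 0 a s = E ⟨a, ha⟩ s := h.pivot_col ⟨a, ha⟩ hI'.2
    have i1 := hint 1 (by omega)
    have i2 := hint 2 (by omega)
    have i3 := hint 3 (by omega)
    have i4 := hint 4 (by omega)
    have ia := hint a (by omega)
    have ib := hint b (by omega)
    have ir := hint r (by omega)
    have is := hint s (by omega)
    have c1 := hE.entry ⟨a, ha⟩ ⟨b, hb⟩
    have c2 := hE.entry ⟨a, ha⟩ s
    have c3 := hE.entry r ⟨b, hb⟩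
    have c4 := hE.entry r s
    have c5 := hE.mul ⟨a, ha⟩ s r ⟨b, hb⟩
    have c6 := hE.div ⟨a, ha⟩ s r ⟨b, hb⟩ r s
    have c7 := hE' ⟨a, ha⟩ ⟨b, hb⟩
    unfold eliminate at c7
    have hset := Exec.setNum (M := M) σ 0 (var 1) (var 2)
      (.sub cell (.div (.mul (.get 0 (var 1) (var 4)) (.get 0 (var 3) (var 2)))
        (.get 0 (var 3) (var 4))))
    simp only [NExp.cost, NExp.eval, cell, var, IExp.cost, IExp.eval, hσa, hσb, hcell, h.row, h.col,
      hp, hrow, hcol] at hset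
    refine ⟨_, _, .branch_true hf hset, by omega, ⟨⟨h.models.m_eq, h.models.n_eq, h.models.k_eq,
      h.models.rows, h.models.cols, fun a' ha' b' hb' => ?_⟩, h.counter, h.row, h.col,
      fun b' hb' => ?_, fun a' ha' => ?_⟩, hσa, hσb⟩
    · have := h.models.entries a' ha' b' hb'
      by_cases hab : (a' : ℕ) = a ∧ (b' : ℕ) = b
      · obtain ⟨rfl, rfl⟩ := eq_of hab.1 hab.2
        simp [Store.writeNum, seen_succ, hI', hJ', eliminate]
      · simp only [Matrix.of_apply] at this
        have hnums : (σ.writeNum 0 a b (E ⟨a, ha⟩ ⟨b, hb⟩ -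
            E ⟨a, ha⟩ s * E r ⟨b, hb⟩ / E r s)).nums 0 a' b' = σ.nums 0 a' b' := by
          simp [Store.writeNum, hab]
        exact hnums.trans (this.trans (if_congr (by simp [seen_succ, hab]) rfl rfl))
    · have : ¬ ((r : ℕ) = a ∧ (b' : ℕ) = b) := fun h => hI'.1 (Fin.ext h.1.symm)
      simp [Store.writeNum, this, h.pivot_row b' hb']
    · have : ¬ ((a' : ℕ) = a ∧ (s : ℕ) = b) := fun h => hJ'.1 (Fin.ext h.2.symm)
      simp [Store.writeNum, this, h.pivot_col a' ha']
  · refine ⟨_, σ, .branch_false hf (.skip σ), by omega,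
      ⟨⟨h.models.m_eq, h.models.n_eq, h.models.k_eq, h.models.rows, h.models.cols,
        fun a' ha' b' hb' => ?_⟩, h.counter, h.row, h.col, h.pivot_row, h.pivot_col⟩, hσa, hσb⟩
    have := h.models.entries a' ha' b' hb'
    have hab : ¬ ((a' : ℕ) = a ∧ (b' : ℕ) = b) := by
      rintro ⟨h1, h2⟩
      obtain ⟨rfl, rfl⟩ := eq_of h1 h2
      exact hf (hfree.2 ⟨ha', hb'⟩)
    simp only [Matrix.of_apply] at this
    exact this.trans (if_congr (by simp [seen_succ, hab]) rfl rfl)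

/-- The cost of one loop over all cells. -/
def cellsCost (m n C : ℕ) : ℕ := (m + 1) * ((n + 1) * (40 * C + 10 + 9 * C + 2) + 9 * C + 2)

theorem spec_pivotRound [IsStrictOrderedRing K] {A : Matrix (Fin m) (Fin n) K}
    (hint : ∀ c ≤ m + n + 4, M.int c ≤ C) (hzero : M.num 0 ≤ C)
    (hnum : ∀ i E I J D, Reach A i E I J D → Charged M C E) (hi : i < k) (hkm : k ≤ m)
    (hkn : k ≤ n) :
    Spec M (fun σ => (∃ E I J D, Reach A i E I J D ∧ Models k E I J σ) ∧ σ.ints 3 0 = i) pivotRound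
      (2 * cellsCost m n C + 9 * C + 3)
      (fun σ => (∃ E I J D, Reach A (i + 1) E I J D ∧ Models k E I J σ) ∧ σ.ints 3 0 = i) := by
  rintro σ ⟨⟨E, I, J, D, hreach, hσ⟩, hσi⟩
  have hE := hnum _ _ _ _ _ hreach
  have hscan := spec_forCells (M := M) (m := m) (n := n) (ScanInv k i E I J) hint (by omega)
    (by omega) (by omega)
    (by
      rintro a b σ v x hx h
      have h0 : ¬ (0 = x) := by omega
      have h3 : ¬ (3 = x) := by omega
      have h4 : ¬ (4 = x) := by omega
      have hfound : Found E I J (σ.writeInt 3 x v) ↔ Found E I J σ := by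
        simp [Found, Store.writeInt, h3, h4]
      exact ⟨⟨h.models.m_eq, h.models.n_eq, h.models.k_eq, h.models.rows, h.models.cols,
        h.models.entries⟩, by simpa [Store.writeInt, h0] using h.counter, by
        rw [hfound]; exact h.start, by rw [hfound]; exact h.max⟩)
    (fun a b σ h => h.models.m_eq) (fun a b σ h => h.models.n_eq)
    (fun a σ h => ⟨h.models, h.counter, h.start, fun a' b' hs => h.max a' b' (seen_row_end.2 hs)⟩)
    (spec_scanCell hint hzero hE)
  obtain ⟨t, τ, hτE, ht, hτ⟩ := hscan (σ.writeNum 1 0 0 0)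
    ⟨⟨hσ.m_eq, hσ.n_eq, hσ.k_eq, hσ.rows, hσ.cols,
      fun a ha b hb => by simpa [Store.writeNum] using hσ.entries a ha b hb⟩, hσi,
      .inl (by simp [Store.writeNum]), fun a' b' hs => absurd hs (not_seen_zero _ _)⟩
  -- Fewer than `k` rows and columns are used up, so the search has met a free cell.
  obtain ⟨a₀, ha₀⟩ : ∃ a, a ∉ I := by
    by_contra! hall
    have := Finset.card_eq_iff_eq_univ I |>.2 (Finset.eq_univ_iff_forall.2 hall)
    rw [hreach.card_rows, Fintype.card_fin] at this
    omega
  obtain ⟨b₀, hb₀⟩ : ∃ b, b ∉ J := by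
    by_contra! hall
    have := Finset.card_eq_iff_eq_univ J |>.2 (Finset.eq_univ_iff_forall.2 hall)
    rw [hreach.card_cols, Fintype.card_fin] at this
    omega
  obtain ⟨-, r, hr, s, hs, hτr, hτs, hbest⟩ := hτ.max a₀ b₀ (seen_all _ _) ha₀ hb₀
  have hmax : ∀ a ∉ I, ∀ b ∉ J, |E a b| ≤ |E r s| := fun a ha b hb => by
    have := (hτ.max a b (seen_all _ _) ha hb).1
    rwa [hbest] at this
  have hreach' := hreach.step hr hs hmax
  have helim := spec_forCells (M := M) (m := m) (n := n) (ElimInv k i E I J r s) hint (by omega)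
    (by omega) (by omega)
    (by
      rintro a b σ v x hx h
      have h0 : ¬ (0 = x) := by omega
      have h3 : ¬ (3 = x) := by omega
      have h4 : ¬ (4 = x) := by omega
      exact ⟨⟨h.models.m_eq, h.models.n_eq, h.models.k_eq, h.models.rows, h.models.cols,
        h.models.entries⟩, by simpa [Store.writeInt, h0] using h.counter,
        by simpa [Store.writeInt, h3] using h.row, by simpa [Store.writeInt, h4] using h.col,
        h.pivot_row, h.pivot_col⟩)
    (fun a b σ h => h.models.m_eq) (fun a b σ h => h.models.n_eq)
    (fun a σ h => by
      refine ⟨⟨h.models.m_eq, h.models.n_eq, h.models.k_eq, h.models.rows, h.models.cols,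
        fun a' ha' b' hb' => (h.models.entries a' ha' b' hb').trans (if_congr ?_ rfl rfl)⟩,
        h.counter, h.row, h.col, h.pivot_row, h.pivot_col⟩
      rw [seen_row_end])
    (spec_elimCell hint hs hE (hnum _ _ _ _ _ hreach').entry)
  have i0 := hint 0 (by omega)
  have i1 := hint 1 (by omega)
  have i3 := hint 3 (by omega)
  have i4 := hint 4 (by omega)
  have ir := hint r (by omega)
  have is := hint s (by omega)
  obtain ⟨u, υ, hυE, hu, hυ⟩ := helim ((τ.writeInt 1 r 1).writeInt 2 s 1)
    ⟨⟨hτ.models.m_eq, hτ.models.n_eq, hτ.models.k_eq,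
      fun a => by
        have := hτ.models.rows a
        by_cases h : a = r
        · simp [Store.writeInt, h]
        · simp [Store.writeInt, this, h, Fin.val_inj],
      fun b => by
        have := hτ.models.cols b
        by_cases h : b = s
        · simp [Store.writeInt, h]
        · simp [Store.writeInt, this, h, Fin.val_inj],
      fun a ha b hb => by
        rw [Finset.mem_insert, not_or] at ha hb
        simpa [Store.writeInt, not_seen_zero] using hτ.models.entries a ha.2 b hb.2⟩,
      hτ.counter, hτr, hτs, fun b' hb' => hτ.models.entries r hr b' hb',
      fun a' ha' => hτ.models.entries a' ha' s hs⟩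
  have hinit := Exec.setNum (M := M) σ 1 (.lit 0) (.lit 0) (.lit 0)
  simp only [IExp.eval, NExp.eval, IExp.cost, NExp.cost, Nat.cast_zero] at hinit
  have hset1 := Exec.setInt (M := M) τ 1 (var 3) (.lit 1)
  simp only [var, IExp.eval, IExp.cost, hτr] at hset1
  have hset2 := Exec.setInt (M := M) (τ.writeInt 1 r 1) 2 (var 4) (.lit 1)
  have hτs' : (τ.writeInt 1 r 1).ints 3 4 = s := hτs
  simp only [var, IExp.eval, IExp.cost, hτs'] at hset2
  refine ⟨_, υ, .seq hinit (.seq hτE (.seq (.seq hset1 hset2) hυE)), ?_,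
    ⟨_, _, _, _, hreach', ⟨hυ.models.m_eq, hυ.models.n_eq, hυ.models.k_eq, hυ.models.rows,
      hυ.models.cols, fun a ha b hb => ?_⟩⟩, hυ.counter⟩
  · unfold cellsCost
    omega
  · rw [hυ.models.entries a ha b hb]
    rw [Finset.mem_insert, not_or] at ha hb
    simp [ha, hb, seen_all]

theorem spec_completePivoting [IsStrictOrderedRing K] {A : Matrix (Fin m) (Fin n) K}
    (hint : ∀ c ≤ m + n + 4, M.int c ≤ C) (hzero : M.num 0 ≤ C)
    (hnum : ∀ i E I J D, Reach A i E I J D → Charged M C E) (hkm : k ≤ m) (hkn : k ≤ n) :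
    Spec M (fun σ => σ = input A k) completePivoting
      ((k + 1) * (2 * cellsCost m n C + 9 * C + 3 + 9 * C + 2))
      (fun σ => ∃ E I J D, Reach A k E I J D ∧ Models k E I J σ) := by
  have := spec_forLoop (M := M) (x := 0) (y := 2) (N := k)
    (fun i σ => ∃ E I J D, Reach A i E I J D ∧ Models k E I J σ) hint (by omega) (by omega)
    (by omega) (by omega)
    (by
      rintro j σ v ⟨E, I, J, D, hreach, h⟩
      exact ⟨E, I, J, D, hreach, h.m_eq, h.n_eq, h.k_eq, h.rows, h.cols, h.entries⟩)
    (fun j σ ⟨E, I, J, D, hreach, h⟩ => h.k_eq)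
    (fun j hj => spec_pivotRound hint hzero hnum hj hkm hkn)
  rintro σ rfl
  refine this _ ⟨A, ∅, ∅, 1, .zero, ?_⟩
  constructor <;> simp [input]

theorem runtime_le (hk : k ≤ m) (hC : 1 ≤ C) :
    (k + 1) * (2 * cellsCost m n C + 9 * C + 3 + 9 * C + 2) ≤ 200 * C * (m + n + 1) ^ 3 := by
  set s := m + n + 1
  have h1 : cellsCost m n C ≤ 72 * C * s ^ 2 := by
    have hs : 1 ≤ s := by omega
    calc cellsCost m n C ≤ s * (s * (61 * C) + 11 * C) := by
          unfold cellsCost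
          exact Nat.mul_le_mul (by omega)
            ((by have := Nat.mul_le_mul (show n + 1 ≤ s by omega)
                  (show 40 * C + 10 + 9 * C + 2 ≤ 61 * C by omega)
                 omega))
      _ ≤ s * (s * (61 * C) + s * (11 * C)) := by 
          exact Nat.mul_le_mul_left _ (Nat.add_le_add_left (Nat.le_mul_of_pos_left _ hs) _)
      _ = 72 * C * s ^ 2 := by ring
  have h2 : C ≤ C * s ^ 2 := Nat.le_mul_of_pos_right _ (by positivity)
  calc _ ≤ s * (200 * C * s ^ 2) := Nat.mul_le_mul (by omega) (by nlinarith)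
    _ = _ := by ring

/-- The program halts in time polynomial in `m + n` and `C` and returns an almost maximum
subdeterminant, provided that the small integers and the numbers that occur cost at most `C`. -/
theorem exec_completePivoting [IsStrictOrderedRing K] {A : Matrix (Fin m) (Fin n) K} (hC : 1 ≤ C)
    (hint : ∀ c ≤ m + n + 4, M.int c ≤ C) (hzero : M.num 0 ≤ C)
    (hnum : ∀ i E I J D, Reach A i E I J D → Charged M C E) (hkm : k ≤ m) (hkn : k ≤ n) :
    ∃ (t : ℕ) (σ : Store K) (S : IndexPair m n k),
      Exec M completePivoting (input A k) t σ ∧ t ≤ 200 * C * (m + n + 1) ^ 3 ∧ Outputs σ S ∧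
      ∀ (f : Fin k → Fin m) (g : Fin k → Fin n),
        |(A.submatrix f g).det| ≤ ((n : K) + m) ^ (2 * k) *
          |(A.submatrix (S.1.1.orderEmbOfFin S.1.2) (S.2.1.orderEmbOfFin S.2.2)).det| := by
  obtain ⟨t, σ, hexec, ht, E, I, J, D, hreach, hσ⟩ :=
    spec_completePivoting hint hzero hnum hkm hkn _ rfl
  refine ⟨t, σ, (⟨I, hreach.card_rows⟩, ⟨J, hreach.card_cols⟩), hexec,
    ht.trans (runtime_le hkm hC), ⟨fun a => ?_, fun b => ?_⟩,
    hreach.abs_det_le_minor hkm hkn _ _⟩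
  · rw [hσ.rows]
    simp
  · rw [hσ.cols]
    simp

end Correctness

theorem charged_unitCost {K : Type} [Field K] {m n : ℕ} (E : Matrix (Fin m) (Fin n) K) :
    Charged (unitCost K) 1 E :=
  ⟨fun _ _ => le_rfl, fun _ _ _ _ => le_rfl, fun _ _ _ _ _ _ => le_rfl⟩

theorem Reach.charged_bitCost {m n i : ℕ} {A E : Matrix (Fin m) (Fin n) ℚ} {I : Finset (Fin m)}
    {J : Finset (Fin n)} {D : ℚ} (h : Reach A i E I J D) :
    Charged bitCost (3 * entryBound (inputSize A) + inputSize A + 5) E := by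
  have hE := h.bitLength_le
  have hmul (a b a' b') : bitLength (E a b * E a' b') ≤ 2 * entryBound (inputSize A) := by
    have := bitLength_mul_le (E a b) (E a' b')
    have := hE a b
    have := hE a' b'
    omega
  refine ⟨fun a b => ?_, fun a b a' b' => ?_, fun a b a' b' r s => ?_⟩
  · exact (hE a b).trans (by omega)
  · exact (hmul a b a' b').trans (by omega)
  · refine (bitLength_div_le_add _ _).trans ?_
    have := hmul a b a' b'
    have := hE r s
    omega

end Subdet

theorem lemma3p5 :
    ∃ (P : Subdet.Prog) (c : ℕ) (p q : Polynomial ℕ),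
      (∀ (m n k : ℕ) (A : Matrix (Fin m) (Fin n) ℝ), k ≤ m → k ≤ n →
        ∃ (t : ℕ) (σ : Subdet.Store ℝ) (S₀ : Subdet.IndexPair m n k),
          Subdet.Exec (Subdet.unitCost ℝ) P (Subdet.input A k) t σ ∧
          t ≤ p.eval (m + n) ∧
          Subdet.Outputs σ S₀ ∧
          Subdet.maxdet k A ≤ ((n : ℝ) + (m : ℝ)) ^ (c * k) * |Subdet.minor A S₀|) ∧
      (∀ (m n k : ℕ) (A : Matrix (Fin m) (Fin n) ℚ), k ≤ m → k ≤ n →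
        ∃ (t : ℕ) (σ : Subdet.Store ℚ) (S₀ : Subdet.IndexPair m n k),
          Subdet.Exec Subdet.bitCost P (Subdet.input A k) t σ ∧
          t ≤ q.eval (Subdet.inputSize A) ∧
          Subdet.Outputs σ S₀ ∧
          Subdet.maxdet k (A.map (fun x : ℚ => (x : ℝ))) ≤
            ((n : ℝ) + (m : ℝ)) ^ (c * k) *
              |Subdet.minor (A.map (fun x : ℚ => (x : ℝ))) S₀|) := by
  open Polynomial in
  refine ⟨Subdet.completePivoting, 2, 200 * (X + 1) ^ 3,
    200 * (3 * (2 * ((X + 1) * (3 * X + 1) + X) + 3) + X + 5) * (X + 1) ^ 3, ?_, ?_⟩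
  · intro m n k A hkm hkn
    obtain ⟨t, σ, S, hexec, ht, hout, hdet⟩ := Subdet.exec_completePivoting (M := Subdet.unitCost ℝ) (A := A)
      le_rfl (fun _ _ => le_rfl) le_rfl (fun _ E _ _ _ _ => Subdet.charged_unitCost E) hkm hkn
    refine ⟨t, σ, S, hexec, by simpa using ht, hout, ?_⟩
    exact Real.iSup_le (fun S' => hdet _ _) (by positivity)
  · intro m n k A hkm hkn
    have hL : m + n ≤ Subdet.inputSize A := by
      unfold Subdet.inputSize
      omega
    obtain ⟨t, σ, S, hexec, ht, hout, hdet⟩ := Subdet.exec_completePivoting (M := Subdet.bitCost) (A := A)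
      (C := 3 * Subdet.entryBound (Subdet.inputSize A) + Subdet.inputSize A + 5) (by omega)
      (fun c hc => by
        have : Nat.size c ≤ c := Nat.size_le.2 Nat.lt_two_pow_self
        show Nat.size c + 1 ≤ _
        omega)
      (by
        show Subdet.bitLength 0 ≤ _
        rw [Subdet.bitLength_zero]
        omega)
      (fun _ _ _ _ _ h => h.charged_bitCost) hkm hkn
    refine ⟨t, σ, S, hexec, ?_, hout, ?_⟩
    · refine ht.trans ?_
      simp only [Polynomial.eval_mul, Polynomial.eval_add, Polynomial.eval_pow, Polynomial.eval_X,
        Polynomial.eval_one, Polynomial.eval_ofNat, Subdet.entryBound]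
      gcongr
    · have hcast (f : Fin k → Fin m) (g : Fin k → Fin n) :
          ((A.map (fun x : ℚ => (x : ℝ))).submatrix f g).det = (((A.submatrix f g).det : ℚ) : ℝ) :=
        ((Rat.castHom ℝ).map_det (A.submatrix f g)).symm
      refine Real.iSup_le (fun S' => ?_) (by positivity)
      unfold Subdet.minor
      rw [hcast, hcast]
      exact_mod_cast hdet _ _
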